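/- Let $n\ge 2$. * $B_n$ is the group with generators $\sigma_1,\dots,\sigma_{n-1}$ and relations (R0) $\sigma_i\sigma_j=\sigma_j\sigma_i$ for $|i-j|\ge 2$, and (R3) $\sigma_i\sigma_{i+1}\sigma_i=\sigma_{i+1}\sigma_i\sigma_{i+1}$ for $1\le i\le n-2$. * $VB_n$ (virtual braid group) is the group with generators $\sigma_1,\dots,\sigma_{n-1},\rho_1,\dots,\rho_{n-1}$, relations (R0), (R3), and (V1) $\rho_i\rho_j=\rho_j\rho_i$ and (V2) $\sigma_i\rho_j=\rho_j\sigma_i$ for $|i-j|\ge2$; (V3) $\rho_i^2=1$ for $1\le i\le n-1$; (V4) $\rho_i\rho_{i+1}\rho_i=\rho_{i+1}\rho_i\rho_{i+1}$ and (V5) $\rho_i\sigma_{i+1}\rho_i=\rho_{i+1}\sigma_i\rho_{i+1}$ for $1\le i\le n-2$. * $SB_n$ (singular braid monoid) is the monoid with generators $\sigma_1^{\pm1},\dots,\sigma_{n-1}^{\pm1},\tau_1,\dots,\tau_{n-1}$, relations (R0), (R3), and (R2) $\sigma_i\sigma_i^{-1}=1=\sigma_i^{-1}\sigma_i$ for $1\le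 i\le n-1$; (S1) $\tau_i\tau_j=\tau_j\tau_i$ and (S2) $\tau_i\sigma_j=\sigma_j\tau_i$ for $|i-j|\ge2$; (S3) $\tau_i\sigma_i=\sigma_i\tau_i$ for $1\le i\le n-1$; (S4) $\sigma_i\sigma_j\tau_i=\tau_j\sigma_i\sigma_j$ for $|i-j|=1$. * $SVB_n$ (singular virtual braid monoid) is the monoid with generators $\sigma_1^{\pm1},\dots,\sigma_{n-1}^{\pm1},\rho_1,\dots,\rho_{n-1},\tau_1,\dots,\tau_{n-1}$, relations (R0), (R2), (R3), (S1)–(S4), (V1)–(V5), and (SV1) $\rho_i\tau_j=\tau_j\rho_i$ for $|i-j|\ge2$; (SV2) $\rho_i\tau_{i+1}\rho_i=\rho_{i+1}\tau_i\rho_{i+1}$ for $1\le i\le n-2$. Consider the natural monoid homomorphisms $B_n\to VB_n$, $B_n\to SB_n$, $VB_n\to SVB_n$ and $SB_n\to SVB_n$, sending each generator to the generator of the same name. Then the square $$\begin{array}{ccc} VB_n & \longrightarrow & SVB_n\\ \uparrow & & \uparrow\\ B_n & \longrightarrow & SB_n\end{array}$$ commutes, and each of its four morphisms is injective. -/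

import Mathlib

/-!
Presentations of the braid group, the virtual braid group, the singular braid monoid and the
singular virtual braid monoid on `n` strands. The generators are indexed by `Fin (n - 1)`, whose
element `i` stands for the index `i + 1` in `{1, …, n - 1}`.
-/

namespace SingularVirtualBraid

/-- `|i - j| ≥ 2`. -/
def Far {m : ℕ} (i j : Fin m) : Prop := (i : ℕ) + 2 ≤ j ∨ (j : ℕ) + 2 ≤ i

/-- `j = i + 1`. -/
def Next {m : ℕ} (i j : Fin m) : Prop := (j : ℕ) = (i : ℕ) + 1

/-! ### The braid group -/

/-- Relators (left side times the inverse of the right side) of the braid group. -/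
inductive BRel (n : ℕ) : FreeGroup (Fin (n - 1)) → Prop
  /-- `σ_i σ_j = σ_j σ_i`, `|i - j| ≥ 2` -/
  | r0 (i j : Fin (n - 1)) (h : Far i j) :
      BRel n ((FreeGroup.of i * FreeGroup.of j) * (FreeGroup.of j * FreeGroup.of i)⁻¹)
  /-- `σ_i σ_{i+1} σ_i = σ_{i+1} σ_i σ_{i+1}` -/
  | r3 (i j : Fin (n - 1)) (h : Next i j) :
      BRel n ((FreeGroup.of i * FreeGroup.of j * FreeGroup.of i) *
        (FreeGroup.of j * FreeGroup.of i * FreeGroup.of j)⁻¹)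

/-- The braid group `B_n`. -/
abbrev B (n : ℕ) : Type := PresentedGroup {r : FreeGroup (Fin (n - 1)) | BRel n r}

/-! ### The virtual braid group -/

/-- Generators `σ_i`, `ρ_i` of the virtual braid group. -/
inductive VBGen (n : ℕ) : Type
  | sigma (i : Fin (n - 1)) : VBGen n
  | rho (i : Fin (n - 1)) : VBGen n

/-- The generator `σ_i` in the free group. -/
def VBGen.s {n : ℕ} (i : Fin (n - 1)) : FreeGroup (VBGen n) := FreeGroup.of (VBGen.sigma i)

/-- The generator `ρ_i` in the free group. -/
def VBGen.r {n : ℕ} (i : Fin (n - 1)) : FreeGroup (VBGen n) := FreeGroup.of (VBGen.rho i)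

open VBGen in
/-- Relators of the virtual braid group. -/
inductive VBRel (n : ℕ) : FreeGroup (VBGen n) → Prop
  /-- `σ_i σ_j = σ_j σ_i`, `|i - j| ≥ 2` -/
  | r0 (i j : Fin (n - 1)) (h : Far i j) : VBRel n ((s i * s j) * (s j * s i)⁻¹)
  /-- `σ_i σ_{i+1} σ_i = σ_{i+1} σ_i σ_{i+1}` -/
  | r3 (i j : Fin (n - 1)) (h : Next i j) : VBRel n ((s i * s j * s i) * (s j * s i * s j)⁻¹)
  /-- `ρ_i ρ_j = ρ_j ρ_i`, `|i - j| ≥ 2` -/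
  | v1 (i j : Fin (n - 1)) (h : Far i j) : VBRel n ((r i * r j) * (r j * r i)⁻¹)
  /-- `σ_i ρ_j = ρ_j σ_i`, `|i - j| ≥ 2` -/
  | v2 (i j : Fin (n - 1)) (h : Far i j) : VBRel n ((s i * r j) * (r j * s i)⁻¹)
  /-- `ρ_i ^ 2 = 1` -/
  | v3 (i : Fin (n - 1)) : VBRel n (r i * r i)
  /-- `ρ_i ρ_{i+1} ρ_i = ρ_{i+1} ρ_i ρ_{i+1}` -/
  | v4 (i j : Fin (n - 1)) (h : Next i j) : VBRel n ((r i * r j * r i) * (r j * r i * r j)⁻¹)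
  /-- `ρ_i σ_{i+1} ρ_i = ρ_{i+1} σ_i ρ_{i+1}` -/
  | v5 (i j : Fin (n - 1)) (h : Next i j) : VBRel n ((r i * s j * r i) * (r j * s i * r j)⁻¹)

/-- The virtual braid group `VB_n`. -/
abbrev VB (n : ℕ) : Type := PresentedGroup {r : FreeGroup (VBGen n) | VBRel n r}

/-! ### The singular braid monoid -/

/-- Generators `σ_i`, `σ_i⁻¹`, `τ_i` of the singular braid monoid. -/
inductive SBGen (n : ℕ) : Type
  | sigma (i : Fin (n - 1)) : SBGen n
  | sigmaInv (i : Fin (n - 1)) : SBGen n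
  | tau (i : Fin (n - 1)) : SBGen n

namespace SBGen

/-- The generator `σ_i` in the free monoid. -/
def s {n : ℕ} (i : Fin (n - 1)) : FreeMonoid (SBGen n) := FreeMonoid.of (sigma i)

/-- The generator `σ_i⁻¹` in the free monoid. -/
def sInv {n : ℕ} (i : Fin (n - 1)) : FreeMonoid (SBGen n) := FreeMonoid.of (sigmaInv i)

/-- The generator `τ_i` in the free monoid. -/
def t {n : ℕ} (i : Fin (n - 1)) : FreeMonoid (SBGen n) := FreeMonoid.of (tau i)

end SBGen

open SBGen in
/-- Defining relations of the singular braid monoid. -/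
inductive SBRel (n : ℕ) : FreeMonoid (SBGen n) → FreeMonoid (SBGen n) → Prop
  | r0 (i j : Fin (n - 1)) (h : Far i j) : SBRel n (s i * s j) (s j * s i)
  | r2 (i : Fin (n - 1)) : SBRel n (s i * sInv i) 1
  | r2' (i : Fin (n - 1)) : SBRel n (sInv i * s i) 1
  | r3 (i j : Fin (n - 1)) (h : Next i j) : SBRel n (s i * s j * s i) (s j * s i * s j)
  | s1 (i j : Fin (n - 1)) (h : Far i j) : SBRel n (t i * t j) (t j * t i)
  | s2 (i j : Fin (n - 1)) (h : Far i j) : SBRel n (t i * s j) (s j * t i)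
  | s3 (i : Fin (n - 1)) : SBRel n (t i * s i) (s i * t i)
  /-- `σ_i σ_j τ_i = τ_j σ_i σ_j`, `|i - j| = 1` -/
  | s4 (i j : Fin (n - 1)) (h : Next i j ∨ Next j i) : SBRel n (s i * s j * t i) (t j * s i * s j)

/-- The singular braid monoid `SB_n`. -/
abbrev SB (n : ℕ) : Type := PresentedMonoid (SBRel n)

/-! ### The singular virtual braid monoid -/

/-- Generators `σ_i`, `σ_i⁻¹`, `ρ_i`, `τ_i` of the singular virtual braid monoid. -/
inductive SVBGen (n : ℕ) : Type
  | sigma (i : Fin (n - 1)) : SVBGen n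
  | sigmaInv (i : Fin (n - 1)) : SVBGen n
  | rho (i : Fin (n - 1)) : SVBGen n
  | tau (i : Fin (n - 1)) : SVBGen n

namespace SVBGen

/-- The generator `σ_i` in the free monoid. -/
def s {n : ℕ} (i : Fin (n - 1)) : FreeMonoid (SVBGen n) := FreeMonoid.of (sigma i)

/-- The generator `σ_i⁻¹` in the free monoid. -/
def sInv {n : ℕ} (i : Fin (n - 1)) : FreeMonoid (SVBGen n) := FreeMonoid.of (sigmaInv i)

/-- The generator `ρ_i` in the free monoid. -/
def r {n : ℕ} (i : Fin (n - 1)) : FreeMonoid (SVBGen n) := FreeMonoid.of (rho i)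

/-- The generator `τ_i` in the free monoid. -/
def t {n : ℕ} (i : Fin (n - 1)) : FreeMonoid (SVBGen n) := FreeMonoid.of (tau i)

end SVBGen

open SVBGen in
/-- Defining relations of the singular virtual braid monoid. -/
inductive SVBRel (n : ℕ) : FreeMonoid (SVBGen n) → FreeMonoid (SVBGen n) → Prop
  | r0 (i j : Fin (n - 1)) (h : Far i j) : SVBRel n (s i * s j) (s j * s i)
  | r2 (i : Fin (n - 1)) : SVBRel n (s i * sInv i) 1
  | r2' (i : Fin (n - 1)) : SVBRel n (sInv i * s i) 1
  | r3 (i j : Fin (n - 1)) (h : Next i j) : SVBRel n (s i * s j * s i) (s j * s i * s j)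
  | s1 (i j : Fin (n - 1)) (h : Far i j) : SVBRel n (t i * t j) (t j * t i)
  | s2 (i j : Fin (n - 1)) (h : Far i j) : SVBRel n (t i * s j) (s j * t i)
  | s3 (i : Fin (n - 1)) : SVBRel n (t i * s i) (s i * t i)
  /-- `σ_i σ_j τ_i = τ_j σ_i σ_j`, `|i - j| = 1` -/
  | s4 (i j : Fin (n - 1)) (h : Next i j ∨ Next j i) : SVBRel n (s i * s j * t i) (t j * s i * s j)
  | v1 (i j : Fin (n - 1)) (h : Far i j) : SVBRel n (r i * r j) (r j * r i)
  | v2 (i j : Fin (n - 1)) (h : Far i j) : SVBRel n (s i * r j) (r j * s i)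
  | v3 (i : Fin (n - 1)) : SVBRel n (r i * r i) 1
  | v4 (i j : Fin (n - 1)) (h : Next i j) : SVBRel n (r i * r j * r i) (r j * r i * r j)
  | v5 (i j : Fin (n - 1)) (h : Next i j) : SVBRel n (r i * s j * r i) (r j * s i * r j)
  | sv1 (i j : Fin (n - 1)) (h : Far i j) : SVBRel n (r i * t j) (t j * r i)
  | sv2 (i j : Fin (n - 1)) (h : Next i j) : SVBRel n (r i * t j * r i) (r j * t i * r j)

/-- The singular virtual braid monoid `SVB_n`. -/
abbrev SVB (n : ℕ) : Type := PresentedMonoid (SVBRel n)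

/-! ### The natural morphisms -/

variable {n : ℕ}

/-- `σ_i` as a unit of `SB_n`. -/
def SB.sigmaUnit (i : Fin (n - 1)) : (SB n)ˣ where
  val := PresentedMonoid.of _ (SBGen.sigma i)
  inv := PresentedMonoid.of _ (SBGen.sigmaInv i)
  val_inv := PresentedMonoid.mk_eq_mk_of_rel (SBRel.r2 i)
  inv_val := PresentedMonoid.mk_eq_mk_of_rel (SBRel.r2' i)

/-- `σ_i` as a unit of `SVB_n`. -/
def SVB.sigmaUnit (i : Fin (n - 1)) : (SVB n)ˣ where
  val := PresentedMonoid.of _ (SVBGen.sigma i)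
  inv := PresentedMonoid.of _ (SVBGen.sigmaInv i)
  val_inv := PresentedMonoid.mk_eq_mk_of_rel (SVBRel.r2 i)
  inv_val := PresentedMonoid.mk_eq_mk_of_rel (SVBRel.r2' i)

/-- `ρ_i` as a unit of `SVB_n`; it is its own inverse. -/
def SVB.rhoUnit (i : Fin (n - 1)) : (SVB n)ˣ where
  val := PresentedMonoid.of _ (SVBGen.rho i)
  inv := PresentedMonoid.of _ (SVBGen.rho i)
  val_inv := PresentedMonoid.mk_eq_mk_of_rel (SVBRel.v3 i)
  inv_val := PresentedMonoid.mk_eq_mk_of_rel (SVBRel.v3 i)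

theorem bToVB_rel : ∀ w ∈ {w : FreeGroup (Fin (n - 1)) | BRel n w},
    FreeGroup.lift (fun i => (PresentedGroup.of (VBGen.sigma i) : VB n)) w = 1 := by
  rintro _ (⟨i, j, h⟩ | ⟨i, j, h⟩) <;>
    simp only [map_mul, map_inv, FreeGroup.lift_apply_of]
  · exact PresentedGroup.one_of_mem (rels := {w | VBRel n w}) (VBRel.r0 i j h)
  · exact PresentedGroup.one_of_mem (rels := {w | VBRel n w}) (VBRel.r3 i j h)

/-- The natural morphism `B_n → VB_n`, `σ_i ↦ σ_i`. -/
def bToVB (n : ℕ) : B n →* VB n := PresentedGroup.toGroup bToVB_rel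

theorem bToSB_rel : ∀ w ∈ {w : FreeGroup (Fin (n - 1)) | BRel n w},
    FreeGroup.lift (SB.sigmaUnit (n := n)) w = 1 := by
  rintro _ (⟨i, j, h⟩ | ⟨i, j, h⟩) <;>
    simp only [map_mul, map_inv, FreeGroup.lift_apply_of, mul_inv_eq_one] <;> apply Units.ext
  · exact PresentedMonoid.mk_eq_mk_of_rel (SBRel.r0 i j h)
  · exact PresentedMonoid.mk_eq_mk_of_rel (SBRel.r3 i j h)

/-- The natural morphism `B_n → SB_n`, `σ_i ↦ σ_i`. It takes values in units of `SB_n`. -/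
def bToSB (n : ℕ) : B n →* SB n :=
  (Units.coeHom (SB n)).comp (PresentedGroup.toGroup bToSB_rel)

/-- The units of `SVB_n` to which the generators of `VB_n` are sent. -/
def vbGenUnit : VBGen n → (SVB n)ˣ
  | .sigma i => SVB.sigmaUnit i
  | .rho i => SVB.rhoUnit i

theorem vbToSVB_rel : ∀ w ∈ {w : FreeGroup (VBGen n) | VBRel n w},
    FreeGroup.lift (vbGenUnit (n := n)) w = 1 := by
  rintro _ (⟨i, j, h⟩ | ⟨i, j, h⟩ | ⟨i, j, h⟩ | ⟨i, j, h⟩ | ⟨i⟩ | ⟨i, j, h⟩ | ⟨i, j, h⟩) <;>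
    simp only [map_mul, map_inv, VBGen.s, VBGen.r, FreeGroup.lift_apply_of, mul_inv_eq_one,
      vbGenUnit] <;> apply Units.ext
  · exact PresentedMonoid.mk_eq_mk_of_rel (SVBRel.r0 i j h)
  · exact PresentedMonoid.mk_eq_mk_of_rel (SVBRel.r3 i j h)
  · exact PresentedMonoid.mk_eq_mk_of_rel (SVBRel.v1 i j h)
  · exact PresentedMonoid.mk_eq_mk_of_rel (SVBRel.v2 i j h)
  · exact PresentedMonoid.mk_eq_mk_of_rel (SVBRel.v3 i)
  · exact PresentedMonoid.mk_eq_mk_of_rel (SVBRel.v4 i j h)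
  · exact PresentedMonoid.mk_eq_mk_of_rel (SVBRel.v5 i j h)

/-- The natural morphism `VB_n → SVB_n`, `σ_i ↦ σ_i`, `ρ_i ↦ ρ_i`. It takes values in units
of `SVB_n`. -/
def vbToSVB (n : ℕ) : VB n →* SVB n :=
  (Units.coeHom (SVB n)).comp (PresentedGroup.toGroup vbToSVB_rel)

/-- The elements of `SVB_n` to which the generators of `SB_n` are sent. -/
def sbGenMap : SBGen n → SVB n
  | .sigma i => PresentedMonoid.of _ (SVBGen.sigma i)
  | .sigmaInv i => PresentedMonoid.of _ (SVBGen.sigmaInv i)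
  | .tau i => PresentedMonoid.of _ (SVBGen.tau i)

theorem sbToSVB_rel : ∀ a b : FreeMonoid (SBGen n), SBRel n a b →
    FreeMonoid.lift (sbGenMap (n := n)) a = FreeMonoid.lift (sbGenMap (n := n)) b := by
  rintro _ _ (⟨i, j, h⟩ | i | i | ⟨i, j, h⟩ | ⟨i, j, h⟩ | ⟨i, j, h⟩ | i | ⟨i, j, h⟩) <;>
    simp only [map_mul, map_one, SBGen.s, SBGen.sInv, SBGen.t, FreeMonoid.lift_eval_of, sbGenMap]
  · exact PresentedMonoid.mk_eq_mk_of_rel (SVBRel.r0 i j h)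
  · exact PresentedMonoid.mk_eq_mk_of_rel (SVBRel.r2 i)
  · exact PresentedMonoid.mk_eq_mk_of_rel (SVBRel.r2' i)
  · exact PresentedMonoid.mk_eq_mk_of_rel (SVBRel.r3 i j h)
  · exact PresentedMonoid.mk_eq_mk_of_rel (SVBRel.s1 i j h)
  · exact PresentedMonoid.mk_eq_mk_of_rel (SVBRel.s2 i j h)
  · exact PresentedMonoid.mk_eq_mk_of_rel (SVBRel.s3 i)
  · exact PresentedMonoid.mk_eq_mk_of_rel (SVBRel.s4 i j h)

/-- The natural morphism `SB_n → SVB_n`, `σ_i ↦ σ_i`, `σ_i⁻¹ ↦ σ_i⁻¹`, `τ_i ↦ τ_i`. -/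
def sbToSVB (n : ℕ) : SB n →* SVB n := PresentedMonoid.lift sbGenMap sbToSVB_rel

end SingularVirtualBraid

/-!
# Braids inside virtual, singular and singular virtual braids

Sending each singular generator `τ_i` to `1` gives retractions `SB_n → B_n` and `SVB_n → VB_n`, so
`B_n → SB_n` and `VB_n → SVB_n` are injective. Once `SB_n → SVB_n` is known to be injective, so is
the diagonal of the commuting square, and with it its first factor `B_n → VB_n`. The content is
therefore the injectivity of `SB_n → SVB_n`, for which a left inverse *of sets* is constructed, in
the spirit of the Charney-Paris retraction of an Artin group onto a parabolic subgroup.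

Consider the simply laced Coxeter group `W` with one generator for each transposition of strands,
two of them braiding exactly when the transpositions do not commute. Let `σ_i`, `τ_i` act on
configurations of positive roots of `W` by the simple reflection attached to `(i i+1)`, and let
`ρ_i` act by conjugating the labels of the simple roots by `(i i+1)`. A configuration is a tuple
`x` of positive roots indexed by `Fin (n - 1)` with the inner products of the standard tuple
`α_{(1 2)}, …, α_{(n-1 n)}`; it stands for a coset of the parabolic subgroup `S_n` of `W`, through
the images of the simple roots of `S_n` under the inverse of the shortest representative. A
reflection `e` that would make the root `x k` negative, that is one with `x k = α_e`, fixes the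
coset; there the configuration is left alone, and the crossing is recorded as a crossing of the
classical strands `k`, `k + 1`. All other crossings are forgotten. In this way `SVB_n` acts on
`Config × SB_n` (`svbAct`). At the standard configuration every classical crossing is recorded, so
the action on `(base, 1)` recovers an element of `SB_n` from its image (`svbAct_sbToSVB`).

Two facts make the relations of `SVB_n` hold. A simple reflection `e` permutes the positive roots
other than `α_e` (`IsPosRoot.reflect_of_ne`), so that configurations are preserved. And the inner
products in a configuration control which of the roots `α_e`, `α_e + α_f`, `α_f` of a rank two
subsystem can occur in it together, which gives the braid relations (`crossing_braid`). The roots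
are set up with simple roots labelled by all elements of a group, here `Equiv.Perm ℕ`; only those
labelled by transpositions matter.
-/

namespace SingularVirtualBraid

/-! ### Roots of the simply laced Coxeter group of a group -/

section Roots

variable {H : Type*}

/-- The simple root labelled by `e`. -/
noncomputable def simpleRoot (e : H) : H →₀ ℤ := Finsupp.single e 1

/-- The height of a vector: the sum of its coordinates in the basis of simple roots. -/
noncomputable def height : (H →₀ ℤ) →ₗ[ℤ] ℤ := Finsupp.linearCombination ℤ fun _ => 1

theorem height_simpleRoot (e : H) : height (simpleRoot e) = 1 := by
  simp [height, simpleRoot]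

variable [Group H]

open Classical in
/-- The simply laced Cartan matrix indexed by a group: the entry of two distinct elements is `0` if
they commute and `-1` if they do not. For transpositions this says that the reflections of two
pairs of strands braid when the pairs share exactly one strand. -/
noncomputable def cartan (e f : H) : ℤ := if e = f then 2 else if Commute e f then 0 else -1

theorem cartan_self (e : H) : cartan e e = 2 := if_pos rfl

theorem cartan_comm (e f : H) : cartan e f = cartan f e := by
  have h : Commute e f ↔ Commute f e := Commute.symm_iff
  unfold cartan
  congr 1
  · exact propext eq_comm
  · congr 1
    exact propext h

theorem cartan_of_commute {e f : H} (hne : e ≠ f) (h : Commute e f) : cartan e f = 0 := by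
  simp [cartan, hne, h]

theorem cartan_of_not_commute {e f : H} (h : ¬Commute e f) : cartan e f = -1 := by
  have hne : e ≠ f := fun he => h (he ▸ Commute.refl e)
  simp [cartan, hne, h]

theorem cartan_eq_two_iff {e f : H} : cartan e f = 2 ↔ e = f := by
  unfold cartan; split_ifs <;> simp_all

theorem cartan_eq_zero_iff {e f : H} : cartan e f = 0 ↔ e ≠ f ∧ Commute e f := by
  unfold cartan; split_ifs <;> simp_all

theorem cartan_eq_neg_one_iff {e f : H} : cartan e f = -1 ↔ ¬Commute e f := by
  refine ⟨fun h hc => ?_, cartan_of_not_commute⟩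
  by_cases hne : e = f
  · rw [cartan_eq_two_iff.2 hne] at h; omega
  · rw [cartan_of_commute hne hc] at h; omega

theorem cartan_ne_one (e f : H) : cartan e f ≠ 1 := by
  unfold cartan; split_ifs <;> decide

theorem cartan_conj (p e f : H) :
    cartan (MulAut.conj p e) (MulAut.conj p f) = cartan e f := by
  have h : Commute (MulAut.conj p e) (MulAut.conj p f) ↔ Commute e f := by
    simp only [Commute, SemiconjBy, ← map_mul, EmbeddingLike.apply_eq_iff_eq]
  have h' : MulAut.conj p e = MulAut.conj p f ↔ e = f := (MulAut.conj p).injective.eq_iff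
  unfold cartan
  congr 1
  · exact propext h'
  · congr 1
    exact propext h

/-- The symmetric bilinear form on the root lattice whose Gram matrix is `cartan`. -/
noncomputable def form : (H →₀ ℤ) →ₗ[ℤ] (H →₀ ℤ) →ₗ[ℤ] ℤ :=
  Finsupp.linearCombination ℤ fun e => Finsupp.linearCombination ℤ (cartan e)

@[simp]
theorem form_simpleRoot (e f : H) : form (simpleRoot e) (simpleRoot f) = cartan e f := by
  simp [form, simpleRoot]

theorem form_comm (x y : H →₀ ℤ) : form x y = form y x := by
  have : (form : (H →₀ ℤ) →ₗ[ℤ] (H →₀ ℤ) →ₗ[ℤ] ℤ) = form.flip := by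
    ext e f
    have := form_simpleRoot f e
    rw [cartan_comm, ← form_simpleRoot] at this
    simpa [simpleRoot] using this.symm
  exact congrArg (fun B => B x y) this

/-- The reflection in the simple root `e`. -/
noncomputable def reflect (e : H) (x : H →₀ ℤ) : H →₀ ℤ :=
  x - form x (simpleRoot e) • simpleRoot e

theorem form_reflect_left (e : H) (x y : H →₀ ℤ) :
    form (reflect e x) y = form x y - form x (simpleRoot e) * form y (simpleRoot e) := by
  simp [reflect, form_comm y]

theorem form_reflect_simpleRoot_self (e : H) (x : H →₀ ℤ) :
    form (reflect e x) (simpleRoot e) = -form x (simpleRoot e) := by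
  rw [form_reflect_left, form_simpleRoot, cartan_self]; ring

theorem reflect_reflect (e : H) (x : H →₀ ℤ) : reflect e (reflect e x) = x := by
  rw [reflect, form_reflect_simpleRoot_self, reflect]; module

theorem reflect_eq_iff {e : H} {x y : H →₀ ℤ} : reflect e x = y ↔ x = reflect e y :=
  ⟨fun h => by rw [← h, reflect_reflect], fun h => by rw [h, reflect_reflect]⟩

theorem form_reflect_reflect (e : H) (x y : H →₀ ℤ) :
    form (reflect e x) (reflect e y) = form x y := by
  rw [form_reflect_left, form_comm x, form_reflect_left, form_reflect_simpleRoot_self,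
    form_comm y x]
  ring

theorem reflect_simpleRoot_self (e : H) : reflect e (simpleRoot e) = -simpleRoot e := by
  rw [reflect, form_simpleRoot, cartan_self]; module

theorem reflect_simpleRoot_of_commute {e f : H} (hne : e ≠ f) (h : Commute e f) :
    reflect e (simpleRoot f) = simpleRoot f := by
  rw [reflect, form_simpleRoot, cartan_comm, cartan_of_commute hne h]; module

theorem reflect_simpleRoot_of_not_commute {e f : H} (h : ¬Commute e f) :
    reflect e (simpleRoot f) = simpleRoot e + simpleRoot f := by
  rw [reflect, form_simpleRoot, cartan_comm, cartan_of_not_commute h]; module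

theorem reflect_add_of_not_commute {e f : H} (h : ¬Commute e f) :
    reflect e (simpleRoot e + simpleRoot f) = simpleRoot f := by
  rw [← reflect_simpleRoot_of_not_commute h, reflect_reflect]

theorem reflect_commute {e f : H} (hne : e ≠ f) (h : Commute e f) (x : H →₀ ℤ) :
    reflect e (reflect f x) = reflect f (reflect e x) := by
  have h1 := cartan_of_commute hne h
  have h2 := cartan_of_commute hne.symm h.symm
  rw [reflect, reflect, reflect, reflect]
  simp only [map_sub, map_smul, LinearMap.sub_apply, LinearMap.smul_apply, form_simpleRoot, h1, h2]
  module

theorem reflect_braid {e f : H} (h : ¬Commute e f) (x : H →₀ ℤ) :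
    reflect e (reflect f (reflect e x)) = reflect f (reflect e (reflect f x)) := by
  have h1 := cartan_of_not_commute h
  have h2 : cartan f e = -1 := by rw [cartan_comm, h1]
  simp only [reflect, map_sub, map_smul, LinearMap.sub_apply, LinearMap.smul_apply,
    form_simpleRoot, h1, h2, cartan_self, smul_eq_mul]
  module

/-- The isometry of the root lattice that conjugates the labels of the simple roots by `p`. -/
noncomputable def relabel (p : H) : (H →₀ ℤ) →ₗ[ℤ] H →₀ ℤ :=
  Finsupp.lmapDomain ℤ ℤ (MulAut.conj p)

@[simp]
theorem relabel_simpleRoot (p e : H) :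
    relabel p (simpleRoot e) = simpleRoot (MulAut.conj p e) := by
  simp [relabel, simpleRoot]

theorem relabel_mul (p q : H) (x : H →₀ ℤ) : relabel (p * q) x = relabel p (relabel q x) := by
  simp only [relabel, Finsupp.lmapDomain_apply, map_mul, MulAut.coe_mul, Finsupp.mapDomain_comp]

theorem relabel_one (x : H →₀ ℤ) : relabel 1 x = x := by
  simp only [relabel, Finsupp.lmapDomain_apply, map_one, MulAut.coe_one, Finsupp.mapDomain_id]

theorem form_relabel (p : H) (x y : H →₀ ℤ) : form (relabel p x) (relabel p y) = form x y := by
  have : form.compl₁₂ (relabel p) (relabel p) = form := by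
    ext e f
    have := form_simpleRoot (MulAut.conj p e) (MulAut.conj p f)
    rw [cartan_conj, ← form_simpleRoot, ← relabel_simpleRoot, ← relabel_simpleRoot] at this
    simpa [simpleRoot] using this
  exact congrArg (fun B => B x y) this

theorem relabel_reflect (p e : H) (x : H →₀ ℤ) :
    relabel p (reflect e x) = reflect (MulAut.conj p e) (relabel p x) := by
  rw [reflect, reflect, ← relabel_simpleRoot, form_relabel, map_sub, map_smul]

theorem relabel_injective (p : H) : Function.Injective (relabel p) := by
  refine Function.LeftInverse.injective (g := relabel p⁻¹) fun x => ?_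
  rw [← relabel_mul, inv_mul_cancel, relabel_one]

/-- The vectors obtained from simple roots by reflections that raise the height. These are the
positive real roots; see `IsPosRoot.reflect_of_ne`. -/
inductive IsPosRoot : (H →₀ ℤ) → Prop
  | simple (e : H) : IsPosRoot (simpleRoot e)
  | raise (e : H) {x : H →₀ ℤ} (hx : IsPosRoot x) (h : form x (simpleRoot e) < 0) :
      IsPosRoot (reflect e x)

theorem height_reflect (e : H) (x : H →₀ ℤ) :
    height (reflect e x) = height x - form x (simpleRoot e) := by
  simp [reflect, height_simpleRoot]

theorem IsPosRoot.height_pos {x : H →₀ ℤ} (hx : IsPosRoot x) : 0 < height x := by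
  induction hx with
  | simple e => simp [height_simpleRoot]
  | raise e _ h ih => rw [height_reflect]; omega

/-- A reflected positive root is never the simple root of the reflection, because the preimage
`-α_e` of `α_e` under the reflection `e` is not positive. -/
theorem IsPosRoot.reflect_ne {x : H →₀ ℤ} (hx : IsPosRoot x) (e : H) :
    reflect e x ≠ simpleRoot e := by
  intro h
  rw [reflect_eq_iff, reflect_simpleRoot_self] at h
  have := hx.height_pos
  rw [h, map_neg, height_simpleRoot] at this
  omega

theorem IsPosRoot.relabel {x : H →₀ ℤ} (hx : IsPosRoot x) (p : H) :
    IsPosRoot (relabel p x) := by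
  induction hx with
  | simple e => rw [relabel_simpleRoot]; exact .simple _
  | raise e _ h ih =>
    rw [relabel_reflect]
    exact .raise _ ih (by rwa [← relabel_simpleRoot, form_relabel])

/-- A simple reflection permutes the positive roots other than its own simple root. By induction on
the height: if `e` lowers `x = s_f y`, then, moving `y` down and up again inside its orbit under the
dihedral group of `e` and `f`, one reaches `s_e x` by raising steps from lower positive roots. -/
theorem IsPosRoot.reflect_of_ne {x : H →₀ ℤ} (hx : IsPosRoot x) {e : H} (hne : x ≠ simpleRoot e) :
    IsPosRoot (reflect e x) := by
  obtain ⟨N, hN⟩ : ∃ N : ℕ, height x ≤ N := ⟨(height x).toNat, Int.self_le_toNat _⟩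
  induction N generalizing x e with
  | zero => have := hx.height_pos; omega
  | succ N ih =>
    rcases lt_trichotomy (form x (simpleRoot e)) 0 with h | h | h
    · exact .raise e hx h
    · rwa [reflect, h, zero_smul, sub_zero]
    cases hx with
    | simple f =>
      have hfe : f ≠ e := fun hf => hne (hf ▸ rfl)
      rw [form_simpleRoot] at h
      by_cases hc : Commute f e
      · rw [cartan_of_commute hfe hc] at h; omega
      · rw [cartan_of_not_commute hc] at h; omega
    | @raise f y hy hf =>
      rw [height_reflect] at hN
      by_cases hfe : f = e
      · subst hfe; rwa [reflect_reflect]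
      rw [form_reflect_left, form_simpleRoot] at h
      by_cases hc : Commute f e
      · rw [cartan_comm, cartan_of_commute hfe hc] at h
        have hye : y ≠ simpleRoot e := by
          rintro rfl
          rw [form_simpleRoot, cartan_comm, cartan_of_commute hfe hc] at hf
          omega
        rw [← reflect_commute hfe hc]
        refine .raise f (ih hy hye (by omega)) ?_
        rw [form_reflect_left, form_simpleRoot, cartan_of_commute hfe hc]
        omega
      · have hc' : ¬Commute e f := fun h => hc h.symm
        have h1 := cartan_of_not_commute hc
        have h2 := cartan_of_not_commute hc'
        rw [h2] at h
        by_cases hye : y = simpleRoot e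
        · rw [hye, reflect_simpleRoot_of_not_commute hc, add_comm,
            reflect_add_of_not_commute hc']
          exact .simple f
        -- The path `y`, `s_e y`, `s_f s_e y`, `s_e s_f s_e y`, `s_f s_e s_f s_e y = s_e s_f y`: two
        -- steps down, covered by induction, and two raising steps.
        have hz : IsPosRoot (reflect e y) := ih hy hye (by omega)
        have hzf : reflect e y ≠ simpleRoot f := by
          intro hz
          rw [reflect_eq_iff, reflect_simpleRoot_of_not_commute hc'] at hz
          rw [hz] at hf
          simp [h2, cartan_self] at hf
        have hw := ih hz hzf (by rw [height_reflect]; omega)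
        have hwe := IsPosRoot.raise e hw (by
          simp only [form_reflect_left, form_simpleRoot, h1, h2, cartan_self]
          omega)
        have hwf := IsPosRoot.raise f hwe (by
          simp only [form_reflect_left, form_simpleRoot, h1, h2, cartan_self]
          omega)
        rwa [reflect_braid hc', reflect_reflect] at hwf

end Roots

/-! ### Crossings acting on configurations of positive roots -/

section Configurations

variable {H κ M : Type*} [Group H] {c : κ → H}

/-- A configuration: positive roots, indexed by `κ`, with the same inner products as the simple
roots labelled by `c`. -/
def Config (c : κ → H) : Type _ :=
  {x : κ → H →₀ ℤ // (∀ k, IsPosRoot (x k)) ∧ ∀ k l, form (x k) (x l) = cartan (c k) (c l)}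

namespace Config

instance : CoeFun (Config c) fun _ => κ → H →₀ ℤ := ⟨Subtype.val⟩

@[ext]
theorem ext {x y : Config c} (h : ∀ k, x k = y k) : x = y := Subtype.ext (funext h)

theorem form_apply (x : Config c) (k l : κ) : form (x k) (x l) = cartan (c k) (c l) := x.2.2 k l

/-- The configuration made of the simple roots labelled by `c`. -/
noncomputable def base (c : κ → H) : Config c :=
  ⟨fun k => simpleRoot (c k), fun k => .simple (c k), fun k l => form_simpleRoot (c k) (c l)⟩

/-- The reflection of a configuration that does not contain the simple root `e`. -/
noncomputable def reflect (e : H) (x : Config c) (h : ∀ k, x k ≠ simpleRoot e) : Config c :=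
  ⟨fun k => SingularVirtualBraid.reflect e (x k), fun k => (x.2.1 k).reflect_of_ne (h k),
    fun k l => by rw [form_reflect_reflect, form_apply]⟩

@[simp]
theorem reflect_apply (e : H) (x : Config c) (h : ∀ k, x k ≠ simpleRoot e) (k : κ) :
    x.reflect e h k = SingularVirtualBraid.reflect e (x k) := rfl

theorem reflect_ne (e : H) (x : Config c) (h : ∀ k, x k ≠ simpleRoot e) (k : κ) :
    x.reflect e h k ≠ simpleRoot e := (x.2.1 k).reflect_ne e

/-- The relabelling of a configuration by conjugation with `p`. -/
noncomputable def relabel (p : H) (x : Config c) : Config c :=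
  ⟨fun k => SingularVirtualBraid.relabel p (x k), fun k => (x.2.1 k).relabel p,
    fun k l => by rw [form_relabel, form_apply]⟩

@[simp]
theorem relabel_apply (p : H) (x : Config c) (k : κ) :
    x.relabel p k = SingularVirtualBraid.relabel p (x k) := rfl

end Config

/-- The action of a virtual crossing: it relabels the configuration and records nothing. -/
noncomputable def virtualCrossing (p : H) : Function.End (Config c × M) := fun z =>
  (z.1.relabel p, z.2)

theorem virtualCrossing_mul (p q : H) :
    virtualCrossing (M := M) (c := c) (p * q) = virtualCrossing p * virtualCrossing q := by
  funext ⟨x, m⟩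
  exact Prod.ext (Config.ext fun k => relabel_mul p q (x k)) rfl

theorem virtualCrossing_one : virtualCrossing (M := M) (c := c) 1 = 1 := by
  funext ⟨x, m⟩
  exact Prod.ext (Config.ext fun k => relabel_one (x k)) rfl

variable [Monoid M]

open Classical in
/-- The action of a crossing of the strands exchanged by `e`. If the simple root `e` is the `k`-th
member of the configuration, then the crossing is classical and is recorded as `f k`; otherwise
the configuration is reflected and nothing is recorded. -/
noncomputable def crossing (e : H) (f : κ → M) : Function.End (Config c × M) := fun z =>
  if h : ∃ k, z.1 k = simpleRoot e then (z.1, f h.choose * z.2)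
  else (z.1.reflect e fun k hk => h ⟨k, hk⟩, z.2)

/-- The index `k` in the definition of `crossing` is unique: two members of a configuration that are
equal have inner product `2`. -/
theorem crossing_of_eq (hc : Function.Injective c) {e : H} (f : κ → M) {x : Config c} {k : κ}
    (hk : x k = simpleRoot e) (b : M) : crossing e f (x, b) = (x, f k * b) := by
  have h : ∃ k, x k = simpleRoot e := ⟨k, hk⟩
  have hkk : h.choose = k := hc <| cartan_eq_two_iff.1 <| by
    rw [← x.form_apply, h.choose_spec, hk, form_simpleRoot, cartan_self]
  rw [crossing, dif_pos h, hkk]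

theorem crossing_of_ne {e : H} (f : κ → M) {x : Config c} (h : ∀ k, x k ≠ simpleRoot e) (b : M) :
    crossing e f (x, b) = (x.reflect e h, b) :=
  dif_neg fun ⟨k, hk⟩ => h k hk

theorem crossing_mul_crossing (hc : Function.Injective c) (e : H) (f g : κ → M) :
    crossing (c := c) e f * crossing e g = crossing e (f * g) * crossing e 1 := by
  funext ⟨x, b⟩
  change crossing e f (crossing e g (x, b)) = crossing e (f * g) (crossing e 1 (x, b))
  by_cases h : ∃ k, x k = simpleRoot e
  · obtain ⟨k, hk⟩ := h
    simp only [crossing_of_eq hc _ hk, Pi.mul_apply, Pi.one_apply, one_mul, mul_assoc]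
  · push Not at h
    simp only [crossing_of_ne _ h, crossing_of_ne _ (x.reflect_ne e h)]

theorem crossing_one_mul_crossing_one (hc : Function.Injective c) (e : H) :
    crossing (M := M) (c := c) e 1 * crossing e 1 = 1 := by
  funext ⟨x, b⟩
  change crossing e 1 (crossing e 1 (x, b)) = (x, b)
  by_cases h : ∃ k, x k = simpleRoot e
  · obtain ⟨k, hk⟩ := h
    simp only [crossing_of_eq hc _ hk, Pi.one_apply, one_mul]
  · push Not at h
    simp only [crossing_of_ne _ h, crossing_of_ne _ (x.reflect_ne e h)]
    congr 1
    ext1 k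
    simp [reflect_reflect]

/-- The relation of distant crossings. If both crossings are classical, the inner product `0` of the
two roots shows that they are recorded on distant strands. -/
theorem crossing_commute (hc : Function.Injective c) {e f : H} (hne : e ≠ f) (hef : Commute e f)
    {a b : κ → M} (hab : ∀ k l, c k ≠ c l → Commute (c k) (c l) → a k * b l = b l * a k) :
    crossing (c := c) e a * crossing f b = crossing f b * crossing e a := by
  funext ⟨x, m⟩
  change crossing e a (crossing f b (x, m)) = crossing f b (crossing e a (x, m))
  have hre := reflect_simpleRoot_of_commute hne hef
  have hrf := reflect_simpleRoot_of_commute hne.symm hef.symm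
  by_cases he : ∃ k, x k = simpleRoot e
  · obtain ⟨k, hk⟩ := he
    by_cases hf : ∃ l, x l = simpleRoot f
    · obtain ⟨l, hl⟩ := hf
      have hkl := x.form_apply k l
      rw [hk, hl, form_simpleRoot, cartan_of_commute hne hef, eq_comm, cartan_eq_zero_iff] at hkl
      simp only [crossing_of_eq hc _ hk, crossing_of_eq hc _ hl, ← mul_assoc,
        hab k l hkl.1 hkl.2]
    · push Not at hf
      have hk' : x.reflect f hf k = simpleRoot e := by simp [hk, hrf]
      simp only [crossing_of_eq hc _ hk, crossing_of_ne _ hf, crossing_of_eq hc _ hk']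
  · push Not at he
    by_cases hf : ∃ l, x l = simpleRoot f
    · obtain ⟨l, hl⟩ := hf
      have hl' : x.reflect e he l = simpleRoot f := by simp [hl, hre]
      simp only [crossing_of_eq hc _ hl, crossing_of_ne _ he, crossing_of_eq hc _ hl']
    · push Not at hf
      have he' : ∀ k, x.reflect f hf k ≠ simpleRoot e := fun k => by
        rw [Config.reflect_apply, Ne, reflect_eq_iff, hrf]; exact he k
      have hf' : ∀ k, x.reflect e he k ≠ simpleRoot f := fun k => by
        rw [Config.reflect_apply, Ne, reflect_eq_iff, hre]; exact hf k
      simp only [crossing_of_ne _ he, crossing_of_ne _ hf, crossing_of_ne _ he',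
        crossing_of_ne _ hf']
      congr 1
      ext1 k
      simp only [Config.reflect_apply, reflect_commute hne hef]

/-- The braid relation of crossings, which covers (R3) for `b = a` and (S4) in general. It depends on
which of the roots `α_e`, `α_f`, `α_e + α_f` occur in the configuration. If there are none, it is
the braid relation of reflections; if there is one, both sides record a single crossing, with the
same label. By the inner products only `α_e` and `α_f` can occur together, and then both sides
record three crossings. -/
theorem crossing_braid (hc : Function.Injective c) {e f : H} (hef : ¬Commute e f)
    {a b : κ → M} (hab : ∀ k l, ¬Commute (c k) (c l) → a k * a l * b k = b l * a k * a l) :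
    crossing (c := c) e a * crossing f a * crossing e b =
      crossing f b * crossing e a * crossing f a := by
  funext ⟨x, m⟩
  change crossing e a (crossing f a (crossing e b (x, m))) =
    crossing f b (crossing e a (crossing f a (x, m)))
  have hfe : ¬Commute f e := fun h => hef h.symm
  have hef1 := cartan_of_not_commute hef
  have hfe1 := cartan_of_not_commute hfe
  have hre := reflect_simpleRoot_of_not_commute hef
  have hrf := reflect_simpleRoot_of_not_commute hfe
  rw [add_comm] at hrf
  have hre' := reflect_add_of_not_commute hef
  have hrf' := reflect_add_of_not_commute hfe
  rw [add_comm] at hrf'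
  by_cases he : ∃ k, x k = simpleRoot e
  · obtain ⟨k, hk⟩ := he
    have hg : ∀ l, x l ≠ simpleRoot e + simpleRoot f := fun l hl => by
      have hkl := x.form_apply k l
      rw [hk, hl, map_add, form_simpleRoot, form_simpleRoot, cartan_self, hef1] at hkl
      exact cartan_ne_one _ _ hkl.symm
    by_cases hf : ∃ l, x l = simpleRoot f
    · obtain ⟨l, hl⟩ := hf
      have hkl := x.form_apply k l
      rw [hk, hl, form_simpleRoot, hef1, eq_comm, cartan_eq_neg_one_iff] at hkl
      simp only [crossing_of_eq hc _ hk, crossing_of_eq hc _ hl, ← mul_assoc, hab k l hkl]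
    · push Not at hf
      have he' : ∀ l, x.reflect f hf l ≠ simpleRoot e := fun l => by
        rw [Config.reflect_apply, Ne, reflect_eq_iff, hrf]; exact hg l
      have hk' : (x.reflect f hf).reflect e he' k = simpleRoot f := by simp [hk, hrf, hre']
      simp only [crossing_of_eq hc _ hk, crossing_of_ne _ hf, crossing_of_ne _ he',
        crossing_of_eq hc _ hk']
  · push Not at he
    by_cases hf : ∃ l, x l = simpleRoot f
    · obtain ⟨l, hl⟩ := hf
      have hg : ∀ k, x k ≠ simpleRoot e + simpleRoot f := fun k hk => by
        have hkl := x.form_apply l k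
        rw [hk, hl, map_add, form_simpleRoot, form_simpleRoot, cartan_self, hfe1] at hkl
        exact cartan_ne_one _ _ hkl.symm
      have hf' : ∀ k, x.reflect e he k ≠ simpleRoot f := fun k => by
        rw [Config.reflect_apply, Ne, reflect_eq_iff, hre]; exact hg k
      have hl' : (x.reflect e he).reflect f hf' l = simpleRoot e := by simp [hl, hre, hrf']
      simp only [crossing_of_eq hc _ hl, crossing_of_ne _ he, crossing_of_ne _ hf',
        crossing_of_eq hc _ hl']
    · push Not at hf
      by_cases hg : ∃ k, x k = simpleRoot e + simpleRoot f
      · obtain ⟨k, hk⟩ := hg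
        have hke : x.reflect e he k = simpleRoot f := by simp [hk, hre']
        have hkf : x.reflect f hf k = simpleRoot e := by simp [hk, hrf']
        simp only [crossing_of_ne _ he, crossing_of_ne _ hf, crossing_of_eq hc _ hke,
          crossing_of_eq hc _ hkf, crossing_of_ne _ (x.reflect_ne e he),
          crossing_of_ne _ (x.reflect_ne f hf)]
        congr 1
        ext1 l
        simp only [Config.reflect_apply, reflect_reflect]
      · push Not at hg
        have he1 : ∀ k, x.reflect f hf k ≠ simpleRoot e := fun k => by
          rw [Config.reflect_apply, Ne, reflect_eq_iff, hrf]; exact hg k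
        have hf1 : ∀ k, x.reflect e he k ≠ simpleRoot f := fun k => by
          rw [Config.reflect_apply, Ne, reflect_eq_iff, hre]; exact hg k
        have he2 : ∀ k, (x.reflect e he).reflect f hf1 k ≠ simpleRoot e := fun k => by
          rw [Config.reflect_apply, Config.reflect_apply, Ne, reflect_eq_iff, reflect_eq_iff, hrf,
            hre']
          exact hf k
        have hf2 : ∀ k, (x.reflect f hf).reflect e he1 k ≠ simpleRoot f := fun k => by
          rw [Config.reflect_apply, Config.reflect_apply, Ne, reflect_eq_iff, reflect_eq_iff, hre,
            hrf']
          exact he k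
        simp only [crossing_of_ne _ he, crossing_of_ne _ hf, crossing_of_ne _ he1,
          crossing_of_ne _ hf1, crossing_of_ne _ he2, crossing_of_ne _ hf2]
        congr 1
        ext1 k
        simp only [Config.reflect_apply, reflect_braid hef]

/-- Virtual crossings conjugate crossings of one pair of strands into those of another, which is the
source of the mixed relations (V2), (V5), (SV1) and (SV2). -/
theorem virtualCrossing_mul_crossing (hc : Function.Injective c) (p e : H) (f : κ → M) :
    virtualCrossing (c := c) p * crossing e f =
      crossing (MulAut.conj p e) f * virtualCrossing p := by
  funext ⟨x, m⟩
  change virtualCrossing p (crossing e f (x, m)) =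
    crossing (MulAut.conj p e) f (x.relabel p, m)
  have key : ∀ k, x.relabel p k = simpleRoot (MulAut.conj p e) ↔ x k = simpleRoot e := fun k => by
    rw [Config.relabel_apply, ← relabel_simpleRoot, (relabel_injective p).eq_iff]
  by_cases h : ∃ k, x k = simpleRoot e
  · obtain ⟨k, hk⟩ := h
    rw [crossing_of_eq hc _ hk, crossing_of_eq hc _ ((key k).2 hk)]
    rfl
  · push Not at h
    rw [crossing_of_ne _ h, crossing_of_ne _ fun k => (key k).not.2 (h k)]
    exact Prod.ext (Config.ext fun k => relabel_reflect p e (x k)) rfl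

theorem virtualCrossing_mul_crossing_of_commute (hc : Function.Injective c) {p e : H}
    (h : Commute p e) (f : κ → M) :
    virtualCrossing (c := c) p * crossing e f = crossing e f * virtualCrossing p := by
  rw [virtualCrossing_mul_crossing hc, MulAut.conj_apply, h.eq, mul_inv_cancel_right]

end Configurations

/-! ### The action of the singular virtual braid monoid -/

section Action

variable {n : ℕ}

open Equiv

/-- The transposition of the positions `i` and `i + 1`, as a permutation of `ℕ`. -/
def adjSwap (i : Fin (n - 1)) : Perm ℕ := swap (i : ℕ) (i + 1)

theorem adjSwap_injective : Function.Injective (adjSwap (n := n)) := by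
  intro i j h
  have h1 := congrArg (· (i : ℕ)) h
  have h2 := congrArg (· (j : ℕ)) h
  simp only [adjSwap, swap_apply_def, if_true] at h1 h2
  ext
  split_ifs at h1 h2 <;> omega

theorem adjSwap_mul_self (i : Fin (n - 1)) : adjSwap i * adjSwap i = 1 := swap_mul_self _ _

theorem adjSwap_inv (i : Fin (n - 1)) : (adjSwap i)⁻¹ = adjSwap i := swap_inv _ _

theorem adjSwap_braid {i j : Fin (n - 1)} (h : Next i j) :
    adjSwap i * adjSwap j * adjSwap i = adjSwap j * adjSwap i * adjSwap j := by
  unfold Next at h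
  ext m
  simp only [adjSwap, h, Perm.mul_apply, swap_apply_def]
  split_ifs <;> omega

theorem adjSwap_commute {i j : Fin (n - 1)} (h : Far i j) : Commute (adjSwap i) (adjSwap j) := by
  unfold Far at h
  refine Equiv.ext fun m => ?_
  simp only [adjSwap, Perm.mul_apply, swap_apply_def]
  split_ifs <;> omega

theorem adjSwap_not_commute {i j : Fin (n - 1)} (h : Next i j) :
    ¬Commute (adjSwap i) (adjSwap j) := by
  unfold Next at h
  intro hc
  have := congrArg (· (i : ℕ)) hc.eq
  simp only [adjSwap, h, Perm.mul_apply, swap_apply_def, if_true] at this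
  split_ifs at this <;> omega

theorem Far.ne {i j : Fin (n - 1)} (h : Far i j) : i ≠ j := by
  rintro rfl; unfold Far at h; omega

theorem far_of_commute {i j : Fin (n - 1)} (hne : adjSwap i ≠ adjSwap j)
    (h : Commute (adjSwap i) (adjSwap j)) : Far i j := by
  have h0 : (i : ℕ) ≠ j := fun hij => hne (congrArg adjSwap (Fin.ext hij))
  have h1 : ¬Next i j := fun hij => adjSwap_not_commute hij h
  have h2 : ¬Next j i := fun hij => adjSwap_not_commute hij h.symm
  unfold Next at h1 h2
  unfold Far
  omega

theorem next_of_not_commute {i j : Fin (n - 1)} (h : ¬Commute (adjSwap i) (adjSwap j)) :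
    Next i j ∨ Next j i := by
  have h0 : i ≠ j := fun hij => h (hij ▸ Commute.refl _)
  have h1 : ¬Far i j := fun hij => h (adjSwap_commute hij)
  rw [Ne, Fin.ext_iff] at h0
  unfold Far at h1
  unfold Next
  omega

/-- The action of the generators of `SVB_n` on configurations with a recorded singular braid. -/
noncomputable def svbGenAct : SVBGen n → Function.End (Config (adjSwap (n := n)) × SB n)
  | .sigma i => crossing (adjSwap i) fun k => PresentedMonoid.of _ (SBGen.sigma k)
  | .sigmaInv i => crossing (adjSwap i) fun k => PresentedMonoid.of _ (SBGen.sigmaInv k)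
  | .rho i => virtualCrossing (adjSwap i)
  | .tau i => crossing (adjSwap i) fun k => PresentedMonoid.of _ (SBGen.tau k)

theorem virtualCrossing_braid_crossing {i j : Fin (n - 1)} (h : Next i j) {M : Type*} [Monoid M]
    (f : Fin (n - 1) → M) :
    virtualCrossing (c := adjSwap) (adjSwap i) * crossing (adjSwap j) f *
        virtualCrossing (adjSwap i) =
      virtualCrossing (adjSwap j) * crossing (adjSwap i) f * virtualCrossing (adjSwap j) := by
  simp only [virtualCrossing_mul_crossing adjSwap_injective, mul_assoc, ← virtualCrossing_mul,
    adjSwap_mul_self, MulAut.conj_apply, adjSwap_inv]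
  rw [← mul_assoc, ← mul_assoc, adjSwap_braid h]

theorem svbGenAct_rel : ∀ a b : FreeMonoid (SVBGen n), SVBRel n a b →
    FreeMonoid.lift (svbGenAct (n := n)) a = FreeMonoid.lift (svbGenAct (n := n)) b := by
  have hinj := adjSwap_injective (n := n)
  have hfar : ∀ {i j : Fin (n - 1)}, Far i j → adjSwap i ≠ adjSwap j := fun h => hinj.ne h.ne
  have hself : ∀ {i : Fin (n - 1)} {f g f' g' : Fin (n - 1) → SB n}, f * g = f' * g' →
      crossing (c := adjSwap) (adjSwap i) f * crossing (adjSwap i) g =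
        crossing (adjSwap i) f' * crossing (adjSwap i) g' := fun h => by
    rw [crossing_mul_crossing hinj, h, ← crossing_mul_crossing hinj]
  have hbraid : ∀ {k l : Fin (n - 1)}, Next k l ∨ Next l k →
      ¬Commute (adjSwap k) (adjSwap l) := fun h =>
    h.elim adjSwap_not_commute fun h hc => adjSwap_not_commute h hc.symm
  rintro _ _ (⟨i, j, h⟩ | i | i | ⟨i, j, h⟩ | ⟨i, j, h⟩ | ⟨i, j, h⟩ | i | ⟨i, j, h⟩ | ⟨i, j, h⟩ |
    ⟨i, j, h⟩ | i | ⟨i, j, h⟩ | ⟨i, j, h⟩ | ⟨i, j, h⟩ | ⟨i, j, h⟩) <;>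
    simp only [map_mul, map_one, SVBGen.s, SVBGen.sInv, SVBGen.r, SVBGen.t,
      FreeMonoid.lift_eval_of, svbGenAct]
  · exact crossing_commute hinj (hfar h) (adjSwap_commute h) fun k l hne hkl =>
      PresentedMonoid.mk_eq_mk_of_rel (SBRel.r0 k l (far_of_commute hne hkl))
  · rw [← crossing_one_mul_crossing_one hinj (adjSwap i)]
    exact hself (funext fun k => PresentedMonoid.mk_eq_mk_of_rel (SBRel.r2 k))
  · rw [← crossing_one_mul_crossing_one hinj (adjSwap i)]
    exact hself (funext fun k => PresentedMonoid.mk_eq_mk_of_rel (SBRel.r2' k))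
  · refine crossing_braid hinj (adjSwap_not_commute h) fun k l hkl => ?_
    rcases next_of_not_commute hkl with h | h
    · exact PresentedMonoid.mk_eq_mk_of_rel (SBRel.r3 k l h)
    · exact (PresentedMonoid.mk_eq_mk_of_rel (SBRel.r3 l k h)).symm
  · exact crossing_commute hinj (hfar h) (adjSwap_commute h) fun k l hne hkl =>
      PresentedMonoid.mk_eq_mk_of_rel (SBRel.s1 k l (far_of_commute hne hkl))
  · exact crossing_commute hinj (hfar h) (adjSwap_commute h) fun k l hne hkl =>
      PresentedMonoid.mk_eq_mk_of_rel (SBRel.s2 k l (far_of_commute hne hkl))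
  · exact hself (funext fun k => PresentedMonoid.mk_eq_mk_of_rel (SBRel.s3 k))
  · exact crossing_braid hinj (hbraid h) fun k l hkl =>
      PresentedMonoid.mk_eq_mk_of_rel (SBRel.s4 k l (next_of_not_commute hkl))
  · rw [← virtualCrossing_mul, ← virtualCrossing_mul, (adjSwap_commute h).eq]
  · exact (virtualCrossing_mul_crossing_of_commute hinj (adjSwap_commute h).symm _).symm
  · rw [← virtualCrossing_mul, adjSwap_mul_self, virtualCrossing_one]
  · simp only [← virtualCrossing_mul, adjSwap_braid h]
  · exact virtualCrossing_braid_crossing h _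
  · exact virtualCrossing_mul_crossing_of_commute hinj (adjSwap_commute h) _
  · exact virtualCrossing_braid_crossing h _

/-- The action of `SVB_n` on configurations with a recorded singular braid. -/
noncomputable def svbAct (n : ℕ) : SVB n →* Function.End (Config (adjSwap (n := n)) × SB n) :=
  PresentedMonoid.lift svbGenAct svbGenAct_rel

/-- At the standard configuration the classical crossings are all recorded. -/
theorem svbAct_sbToSVB (y b : SB n) :
    svbAct n (sbToSVB n y) (Config.base adjSwap, b) = (Config.base adjSwap, y * b) := by
  induction y using PresentedMonoid.inductionOn with | _ w
  induction w using FreeMonoid.inductionOn' generalizing b with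
  | one => rw [map_one, map_one, map_one, one_mul]; rfl
  | of_mul g w ih =>
    rw [map_mul, map_mul, map_mul]
    change svbAct n (sbToSVB n _) (svbAct n (sbToSVB n _) _) = _
    rw [ih, mul_assoc]
    have hk : ∀ i, Config.base adjSwap i = simpleRoot (adjSwap (n := n) i) := fun _ => rfl
    rcases g with i | i | i
    · exact crossing_of_eq adjSwap_injective
        (fun k => (PresentedMonoid.of (SBRel n) (SBGen.sigma k) : SB n)) (hk i) _
    · exact crossing_of_eq adjSwap_injective
        (fun k => (PresentedMonoid.of (SBRel n) (SBGen.sigmaInv k) : SB n)) (hk i) _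
    · exact crossing_of_eq adjSwap_injective
        (fun k => (PresentedMonoid.of (SBRel n) (SBGen.tau k) : SB n)) (hk i) _

theorem sbToSVB_injective (n : ℕ) : Function.Injective (sbToSVB n) := by
  intro y z h
  have hy := svbAct_sbToSVB y 1
  rw [h, svbAct_sbToSVB] at hy
  simpa using (congrArg Prod.snd hy).symm

/-! ### Retractions that forget the singular crossings -/

/-- The generators of the retraction `SB_n → B_n`, `τ_i ↦ 1`. -/
def sbGenToB : SBGen n → B n
  | .sigma i => PresentedGroup.of i
  | .sigmaInv i => (PresentedGroup.of i)⁻¹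
  | .tau _ => 1

theorem B.of_mul_of_far {i j : Fin (n - 1)} (h : Far i j) :
    (PresentedGroup.of i * PresentedGroup.of j : B n) = PresentedGroup.of j * PresentedGroup.of i :=
  mul_inv_eq_one.1 (PresentedGroup.one_of_mem (rels := {w | BRel n w}) (BRel.r0 i j h))

theorem B.of_braid {i j : Fin (n - 1)} (h : Next i j) :
    (PresentedGroup.of i * PresentedGroup.of j * PresentedGroup.of i : B n) =
      PresentedGroup.of j * PresentedGroup.of i * PresentedGroup.of j :=
  mul_inv_eq_one.1 (PresentedGroup.one_of_mem (rels := {w | BRel n w}) (BRel.r3 i j h))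

theorem sbGenToB_rel : ∀ a b : FreeMonoid (SBGen n), SBRel n a b →
    FreeMonoid.lift (sbGenToB (n := n)) a = FreeMonoid.lift (sbGenToB (n := n)) b := by
  rintro _ _ (⟨i, j, h⟩ | i | i | ⟨i, j, h⟩ | ⟨i, j, h⟩ | ⟨i, j, h⟩ | i | ⟨i, j, h⟩) <;>
    simp only [map_mul, map_one, SBGen.s, SBGen.sInv, SBGen.t, FreeMonoid.lift_eval_of, sbGenToB,
      mul_inv_cancel, inv_mul_cancel, one_mul, mul_one]
  · exact B.of_mul_of_far h
  · exact B.of_braid h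

theorem bToSB_injective (n : ℕ) : Function.Injective (bToSB n) := by
  let r : SB n →* B n := PresentedMonoid.lift sbGenToB sbGenToB_rel
  have h : r.comp (bToSB n) = MonoidHom.id _ := PresentedGroup.ext fun i => rfl
  exact Function.LeftInverse.injective (g := r) fun x => DFunLike.congr_fun h x

/-- The generators of the retraction `SVB_n → VB_n`, `τ_i ↦ 1`. -/
def svbGenToVB : SVBGen n → VB n
  | .sigma i => PresentedGroup.of (VBGen.sigma i)
  | .sigmaInv i => (PresentedGroup.of (VBGen.sigma i))⁻¹
  | .rho i => PresentedGroup.of (VBGen.rho i)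
  | .tau _ => 1

theorem VB.mk_eq_of_rel {a b : FreeGroup (VBGen n)} (h : VBRel n (a * b⁻¹)) :
    PresentedGroup.mk {r | VBRel n r} a = PresentedGroup.mk {r | VBRel n r} b :=
  mul_inv_eq_one.1 (PresentedGroup.one_of_mem (rels := {w | VBRel n w}) h)

theorem svbGenToVB_rel : ∀ a b : FreeMonoid (SVBGen n), SVBRel n a b →
    FreeMonoid.lift (svbGenToVB (n := n)) a = FreeMonoid.lift (svbGenToVB (n := n)) b := by
  have hrho : ∀ i : Fin (n - 1), (PresentedGroup.of (VBGen.rho i) * PresentedGroup.of (VBGen.rho i)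
      : VB n) = 1 := fun i => PresentedGroup.one_of_mem (rels := {w | VBRel n w}) (VBRel.v3 i)
  rintro _ _ (⟨i, j, h⟩ | i | i | ⟨i, j, h⟩ | ⟨i, j, h⟩ | ⟨i, j, h⟩ | i | ⟨i, j, h⟩ | ⟨i, j, h⟩ |
    ⟨i, j, h⟩ | i | ⟨i, j, h⟩ | ⟨i, j, h⟩ | ⟨i, j, h⟩ | ⟨i, j, h⟩) <;>
    simp only [map_mul, map_one, SVBGen.s, SVBGen.sInv, SVBGen.r, SVBGen.t,
      FreeMonoid.lift_eval_of, svbGenToVB, mul_inv_cancel, inv_mul_cancel, one_mul, mul_one, hrho]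
  · exact VB.mk_eq_of_rel (VBRel.r0 i j h)
  · exact VB.mk_eq_of_rel (VBRel.r3 i j h)
  · exact VB.mk_eq_of_rel (VBRel.v1 i j h)
  · exact VB.mk_eq_of_rel (VBRel.v2 i j h)
  · exact VB.mk_eq_of_rel (VBRel.v4 i j h)
  · exact VB.mk_eq_of_rel (VBRel.v5 i j h)

theorem vbToSVB_injective (n : ℕ) : Function.Injective (vbToSVB n) := by
  let r : SVB n →* VB n := PresentedMonoid.lift svbGenToVB svbGenToVB_rel
  have h : r.comp (vbToSVB n) = MonoidHom.id _ :=
    PresentedGroup.ext fun g => by cases g <;> rfl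
  exact Function.LeftInverse.injective (g := r) fun x => DFunLike.congr_fun h x

theorem vbToSVB_comp_bToVB (n : ℕ) : (vbToSVB n).comp (bToVB n) = (sbToSVB n).comp (bToSB n) := by
  -- Homs out of a presented group are compared on generators only when the target is a group, so
  -- both composites are read off on units.
  have h : (PresentedGroup.toGroup vbToSVB_rel).comp (bToVB n) =
      (Units.map (sbToSVB n)).comp (PresentedGroup.toGroup bToSB_rel) :=
    PresentedGroup.ext fun i => Units.ext rfl
  exact congrArg (Units.coeHom (SVB n)).comp h

end Action
end SingularVirtualBraid

theorem proposition3p1 (n : ℕ) (hn : 2 ≤ n) :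
    (SingularVirtualBraid.vbToSVB n).comp (SingularVirtualBraid.bToVB n) =
        (SingularVirtualBraid.sbToSVB n).comp (SingularVirtualBraid.bToSB n) ∧
      Function.Injective (SingularVirtualBraid.bToVB n) ∧
      Function.Injective (SingularVirtualBraid.bToSB n) ∧
      Function.Injective (SingularVirtualBraid.vbToSVB n) ∧
      Function.Injective (SingularVirtualBraid.sbToSVB n) := by
  open SingularVirtualBraid in
  have hcomm := vbToSVB_comp_bToVB n
  refine ⟨hcomm, ?_, bToSB_injective n, vbToSVB_injective n, sbToSVB_injective n⟩
  refine Function.Injective.of_comp (f := vbToSVB n) ?_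
  rw [← MonoidHom.coe_comp, hcomm]
  exact (sbToSVB_injective n).comp (bToSB_injective n)
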